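/- Let $\mathbb T=\mathbb R/2\pi\mathbb Z$ and let $f\in L_1(\mathbb T)$ be complex-valued, with Fourier coefficients $\widehat f_k=\frac1{2\pi}\int_{-\pi}^{\pi}f(t)e^{-ikt}\,dt$ and partial sums $s_m(f;x)=\sum_{|k|\le m}\widehat f_k e^{ikx}$. For real $\alpha>1$ let $$\sigma_n^{\alpha}(f;x)=\frac1{A_n^{\alpha}}\sum_{m=0}^{n}A_{n-m}^{\alpha-1}s_m(f;x),\qquad A_n^{\beta}=\binom{n+\beta}{n}=\frac{(\beta+1)(\beta+2)\cdots(\beta+n)}{n!},$$ be the Cesàro $(C,\alpha)$ means of its Fourier series. A point $x\in\mathbb R$ is called a $d$-point of $f$ if $F(y)=\int_0^y f(t)\,dt$ is differentiable at $x$, that is, if the finite limit $$d_f(x)=\lim_{h\to0}\frac1h\int_0^h f(x+t)\,dt$$ exists. Then for every $\alpha>1$, every $f\in L_1(\mathbb T)$ and every $d$-point $x$ of $f$, $$\lim_{n\to\infty}\sigma_n^{\alpha}(f;x)=d_f(x).$$ -/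

import Mathlib

open Filter Topology MeasureTheory

noncomputable section

/-- The circle `𝕋 = ℝ / 2πℤ`. -/
abbrev Torus : Type := AddCircle (2 * Real.pi)

instance torusPeriodPos : Fact (0 < 2 * Real.pi) := ⟨Real.two_pi_pos⟩

/-- The symmetric partial sum `s_m(f; x) = ∑_{|k| ≤ m} f̂ₖ e^{ikx}` of the Fourier series of `f`. -/
def fourierPartialSum (f : Torus → ℂ) (m : ℕ) (x : ℝ) : ℂ :=
  ∑ k ∈ Finset.Icc (-(m : ℤ)) (m : ℤ), fourierCoeff f k * fourier k (x : Torus)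

/-- The Cesàro numbers `A_n^α = binom (n + α) n = (α + 1) ⋯ (α + n) / n!`. -/
def cesaroNumber (α : ℝ) (n : ℕ) : ℝ := Ring.choose (α + n) n

/-- The `n`-th Cesàro `(C, α)` mean of a sequence `s`:
`(1 / A_n^α) ∑_{m=0}^n A_{n-m}^{α-1} s_m`. -/
def cesaroMean (α : ℝ) (s : ℕ → ℂ) (n : ℕ) : ℂ :=
  (∑ m ∈ Finset.range (n + 1), (cesaroNumber (α - 1) (n - m) : ℂ) * s m) / (cesaroNumber α n : ℂ)

/-- `x` is a `d`-point of `f` with value `d = d_f(x)`: the function `F(y) = ∫_0^y f(t) dt` has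
the derivative `d` at `x`. -/
def IsDPoint (f : Torus → ℂ) (x : ℝ) (d : ℂ) : Prop :=
  HasDerivAt (fun y : ℝ => ∫ t in (0 : ℝ)..y, f (t : Torus)) d x

end

/-!
Since the `(C, α + 1)` means are weighted averages of the `(C, α)` means, it is enough to treat
`1 < α ≤ 2`. There `σ_n^α(f; x)` is the integral of `f(x + t)` against `K_n(t) / 2π`, where `K_n`
is the Cesàro kernel. Subtracting `d` and integrating by parts against
`Φ(t) = ∫_0^t (f(x + s) - d) ds = o(t)`, the boundary terms vanish in the limit and there remains
`∫ K_n'(t) Φ(t) dt`. Multiplying `K_n` by `1 - cos t` amounts to a summation by parts, which turns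
it into a trigonometric sum with coefficients `A_{n-m}^{α-2}`; these are monotone as `α ≤ 2`, and
splitting the differentiated sum at `J ≈ 1 / |t|` gives `|K_n'(t)| ≤ C n² (1 + n|t|)^{-α-1}`.
Hence `t K_n'(t)` is dominated by a multiple of the approximate identity `n (1 + n|t|)^{-α}`, which
is integrable because `α > 1`, and concentrates at `0`, where `Φ(t) / t` tends to `0`.
-/

open Finset Real

section WeightedMeans

variable {E : Type*} [NormedAddCommGroup E] [NormedSpace ℝ E]

theorem tendsto_weighted_mean {w : ℕ → ℝ} {u : ℕ → E} {d : E} (hw : 0 ≤ w)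
    (hsum : Tendsto (fun n => ∑ i ∈ range n, w i) atTop atTop) (hu : Tendsto u atTop (𝓝 d)) :
    Tendsto (fun n => (∑ i ∈ range n, w i)⁻¹ • ∑ i ∈ range n, w i • u i) atTop (𝓝 d) := by
  have hsub : (fun i => u i - d) =o[atTop] fun _ => (1 : ℝ) :=
    (Asymptotics.isLittleO_one_iff ℝ).2 (tendsto_sub_nhds_zero_iff.2 hu)
  have hterm : (fun i => w i • (u i - d)) =o[atTop] w := by
    simpa using (Asymptotics.isBigO_refl w atTop).smul_isLittleO hsub
  have hmean := (Asymptotics.isBigO_refl (fun n => (∑ i ∈ range n, w i)⁻¹) atTop).smul_isLittleO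
    (hterm.sum_range hw hsum)
  rw [← tendsto_sub_nhds_zero_iff, ← Asymptotics.isLittleO_one_iff ℝ]
  refine hmean.congr' ?_ ?_
  · filter_upwards [hsum.eventually_ne_atTop 0] with n hn
    simp only [smul_sub, sum_sub_distrib, ← sum_smul]
    rw [smul_smul, inv_mul_cancel₀ hn, one_smul]
  · filter_upwards [hsum.eventually_ne_atTop 0] with n hn
    rw [smul_eq_mul, inv_mul_cancel₀ hn]

end WeightedMeans

section AbelSummation

variable {c : ℕ → ℝ} {w : ℂ}

theorem norm_one_sub_mul_sum_antitone_mul_pow_le (hc : Antitone c) (h0 : 0 ≤ c) (hw : ‖w‖ ≤ 1)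
    (n : ℕ) : ‖(1 - w) * ∑ j ∈ range n, (c j : ℂ) * w ^ j‖ ≤ 2 * c 0 := by
  have hpow (m : ℕ) {r : ℝ} (hr : 0 ≤ r) : ‖(r : ℂ) * w ^ m‖ ≤ r := by
    rw [norm_mul, norm_pow, Complex.norm_of_nonneg hr]
    exact mul_le_of_le_one_right hr (pow_le_one₀ (norm_nonneg w) hw)
  have hvar : ‖(1 - w) * ∑ j ∈ range n, (c j : ℂ) * w ^ j + c n * w ^ n‖ ≤ 2 * c 0 - c n := by
    induction n with
    | zero =>
      have := hpow 0 (h0 0)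
      simp only [range_zero, sum_empty, mul_zero, zero_add]
      linarith
    | succ n ih =>
      have hstep : (1 - w) * ∑ j ∈ range (n + 1), (c j : ℂ) * w ^ j + c (n + 1) * w ^ (n + 1) =
          ((1 - w) * ∑ j ∈ range n, (c j : ℂ) * w ^ j + c n * w ^ n) -
            ((c n - c (n + 1) : ℝ) : ℂ) * w ^ (n + 1) := by
        rw [sum_range_succ]
        push_cast
        ring
      rw [hstep]
      have hdiff := hpow (n + 1) (sub_nonneg.2 (hc n.le_succ))
      linarith [norm_sub_le ((1 - w) * ∑ j ∈ range n, (c j : ℂ) * w ^ j + c n * w ^ n)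
        (((c n - c (n + 1) : ℝ) : ℂ) * w ^ (n + 1))]
  have hlast := norm_le_add_norm_add ((1 - w) * ∑ j ∈ range n, (c j : ℂ) * w ^ j) (c n * w ^ n)
  linarith [hpow n (h0 n)]

theorem norm_sum_antitone_mul_pow_le (hc : Antitone c) (h0 : 0 ≤ c) (hw : ‖w‖ ≤ 1) (hw1 : w ≠ 1)
    {J n : ℕ} (hJ : J ≤ n) :
    ‖∑ j ∈ range n, (c j : ℂ) * w ^ j‖ ≤ ∑ j ∈ range J, c j + 2 * c J / ‖1 - w‖ := by
  obtain ⟨k, rfl⟩ := Nat.exists_eq_add_of_le hJ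
  rw [sum_range_add]
  refine (norm_add_le _ _).trans (add_le_add ?_ ?_)
  · refine norm_sum_le_of_le _ fun j _ => ?_
    rw [norm_mul, norm_pow, Complex.norm_of_nonneg (h0 j)]
    exact mul_le_of_le_one_right (h0 j) (pow_le_one₀ (norm_nonneg w) hw)
  · have hshift : Antitone fun j => c (J + j) := fun i j hij => hc (Nat.add_le_add_left hij J)
    have htail := norm_one_sub_mul_sum_antitone_mul_pow_le hshift (fun j => h0 (J + j)) hw k
    have hfactor : ∑ j ∈ range k, (c (J + j) : ℂ) * w ^ (J + j) =
        w ^ J * ∑ j ∈ range k, (c (J + j) : ℂ) * w ^ j := by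
      rw [mul_sum]
      exact sum_congr rfl fun j _ => by rw [pow_add]; ring
    rw [norm_mul, add_zero, mul_comm] at htail
    rw [hfactor, norm_mul, norm_pow]
    refine (mul_le_of_le_one_left (norm_nonneg _) (pow_le_one₀ (norm_nonneg w) hw)).trans ?_
    rwa [le_div_iff₀ (norm_pos_iff.2 (sub_ne_zero.2 hw1.symm))]

end AbelSummation

section SingularIntegrals

variable {E : Type*} [NormedAddCommGroup E] [NormedSpace ℝ E]

theorem integral_mul_eq_sub_integral_deriv_mul {k φ : ℝ → ℝ} {a b c : ℝ}
    (hk : AbsolutelyContinuousOnInterval k a b) (hφ : IntervalIntegrable φ volume a b)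
    (hc : c ∈ Set.uIcc a b) :
    ∫ y in a..b, k y * φ y = k b * (∫ v in c..b, φ v) - k a * (∫ v in c..a, φ v) -
      ∫ y in a..b, deriv k y * ∫ v in c..y, φ v := by
  rw [← hk.integral_mul_deriv_eq_deriv_mul
    (hφ.absolutelyContinuousOnInterval_intervalIntegral hc)]
  refine intervalIntegral.integral_congr_ae ?_
  filter_upwards [hφ.ae_hasDerivAt_integral] with y hy hyab
  rw [(hy (Set.uIoc_subset_uIcc hyab) c hc).deriv]

theorem integral_smul_eq_sub_integral_deriv_smul [CompleteSpace E] {k : ℝ → ℝ} {φ : ℝ → E}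
    {a b c : ℝ} (hk : AbsolutelyContinuousOnInterval k a b)
    (hφ : IntervalIntegrable φ volume a b) (hc : c ∈ Set.uIcc a b) :
    ∫ y in a..b, k y • φ y = k b • (∫ v in c..b, φ v) - k a • (∫ v in c..a, φ v) -
      ∫ y in a..b, deriv k y • ∫ v in c..y, φ v := by
  have hsub (y : ℝ) (hy : y ∈ Set.uIcc a b) : IntervalIntegrable φ volume c y :=
    hφ.mono_set (Set.uIcc_subset_uIcc hc hy)
  have hkφ : IntervalIntegrable (fun y => k y • φ y) volume a b :=
    hφ.continuousOn_smul hk.continuousOn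
  have hkΦ : IntervalIntegrable (fun y => deriv k y • ∫ v in c..y, φ v) volume a b :=
    hk.intervalIntegrable_deriv.smul_continuousOn
      (intervalIntegral.continuousOn_primitive_interval' hφ hc)
  refine (SeparatingDual.eq_iff_forall_dual_eq (R := ℝ)).2 fun L => ?_
  have hLφ : IntervalIntegrable (fun y => L (φ y)) volume a b :=
    ⟨L.integrable_comp hφ.1, L.integrable_comp hφ.2⟩
  simp only [map_sub, map_smul, smul_eq_mul, ← L.intervalIntegral_comp_comm hkφ,
    ← L.intervalIntegral_comp_comm hkΦ, ← L.intervalIntegral_comp_comm (hsub b Set.right_mem_uIcc),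
    ← L.intervalIntegral_comp_comm (hsub a Set.left_mem_uIcc)]
  rw [integral_mul_eq_sub_integral_deriv_mul hk hLφ hc]
  congr 1
  refine intervalIntegral.integral_congr fun y hy => ?_
  simp only [L.intervalIntegral_comp_comm (hsub y hy)]

theorem integrable_one_add_norm_rpow_smul {a : ℝ} (ha : 0 ≤ a) {g : ℝ → E} (hg : Integrable g)
    (c : ℝ) : Integrable fun t : ℝ => (c * (1 + ‖c * t‖) ^ (-a)) • g t := by
  have hcont : Continuous fun t : ℝ => c * (1 + ‖c * t‖) ^ (-a) :=
    continuous_const.mul ((by fun_prop : Continuous _).rpow_const fun t =>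
      Or.inl (by positivity : (0 : ℝ) < 1 + ‖c * t‖).ne')
  refine hg.bdd_smul ‖c‖ hcont.aestronglyMeasurable (Eventually.of_forall fun t => ?_)
  rw [norm_mul, norm_of_nonneg (rpow_nonneg (by positivity) _)]
  exact mul_le_of_le_one_right (norm_nonneg c) (rpow_le_one_of_one_le_of_nonpos
    (le_add_of_nonneg_right (norm_nonneg _)) (neg_nonpos.2 ha))

theorem tendsto_integral_one_add_norm_rpow_smul [CompleteSpace E] {a : ℝ} (ha : 1 < a) {g : ℝ → E}
    (hg : Integrable g) (hg0 : ContinuousAt g 0) :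
    Tendsto (fun c : ℝ => ∫ t, (c * (1 + ‖c * t‖) ^ (-a)) • g t) atTop
      (𝓝 ((∫ u : ℝ, (1 + ‖u‖) ^ (-a)) • g 0)) := by
  set Z := ∫ u : ℝ, (1 + ‖u‖) ^ (-a)
  have hint : Integrable fun u : ℝ => (1 + ‖u‖) ^ (-a) := integrable_one_add_norm (by simpa)
  have hZ0 : Z ≠ 0 := by
    refine (integral_pos_of_integrable_nonneg_nonzero (x := 0) ?_ hint
      (fun u => by positivity) (by simp)).ne'
    exact (continuous_const.add continuous_norm).rpow_const fun u =>
      Or.inl (by positivity : (0 : ℝ) < 1 + ‖u‖).ne'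
  have hdecay : Tendsto (fun u : ℝ => ‖u‖ * (Z⁻¹ * (1 + ‖u‖) ^ (-a))) (Bornology.cobounded ℝ)
      (𝓝 0) := by
    have hpow : Tendsto (fun u : ℝ => |Z⁻¹| * (1 + ‖u‖) ^ (-(a - 1))) (Bornology.cobounded ℝ)
        (𝓝 0) := by
      have := ((tendsto_rpow_neg_atTop (sub_pos.2 ha)).comp (tendsto_atTop_add_const_left _ 1
        (tendsto_norm_cobounded_atTop (E := ℝ)))).const_mul |Z⁻¹|
      rwa [mul_zero] at this
    refine squeeze_zero_norm (fun u => ?_) hpow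
    have hu : 0 < 1 + ‖u‖ := by positivity
    rw [neg_sub, sub_eq_add_neg, rpow_add hu, rpow_one, norm_mul, norm_norm, norm_mul,
      norm_of_nonneg (rpow_nonneg hu.le _), mul_left_comm, norm_eq_abs]
    gcongr
    linarith
  have hpeak := tendsto_integral_comp_smul_smul_of_integrable (μ := volume)
    (φ := fun u : ℝ => Z⁻¹ * (1 + ‖u‖) ^ (-a))
    (fun u => mul_nonneg (inv_nonneg.2 (integral_nonneg fun u => by positivity)) (by positivity))
    (by rw [integral_const_mul, inv_mul_cancel₀ hZ0])
    (by simpa only [Module.finrank_self, pow_one] using hdecay) hg hg0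
  refine (hpeak.const_smul Z).congr fun c => ?_
  rw [← integral_smul]
  refine integral_congr_ae (Eventually.of_forall fun t => ?_)
  simp only [Module.finrank_self, pow_one, smul_eq_mul, smul_smul]
  congr 1
  field_simp

theorem abs_mul_one_add_abs_rpow_le (a u : ℝ) :
    |u| * (1 + |u|) ^ (-(a + 1)) ≤ (1 + |u|) ^ (-a) := by
  have hu : 0 < 1 + |u| := by positivity
  calc |u| * (1 + |u|) ^ (-(a + 1)) ≤ (1 + |u|) * (1 + |u|) ^ (-(a + 1)) := by
        gcongr
        linarith
    _ = (1 + |u|) ^ (-a) := by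
        nth_rw 1 [← rpow_one (1 + |u|)]
        rw [← rpow_add hu]
        ring_nf

variable {k : ℕ → ℝ → ℝ} {a C r : ℝ}

theorem tendsto_intervalIntegral_smul_of_hasDerivAt_zero {G : ℝ → E} (hr : 0 < r) (ha : 1 < a)
    (hk : ∀ n t, |t| ≤ r → |k n t| ≤ C * n ^ 2 * (1 + |n * t|) ^ (-(a + 1)))
    (hG : ContinuousOn G (Set.Icc (-r) r)) (hG0 : G 0 = 0) (hG' : HasDerivAt G 0 0) :
    Tendsto (fun n => ∫ t in -r..r, k n t • G t) atTop (𝓝 0) := by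
  have hC : 0 ≤ C := by simpa using (abs_nonneg _).trans (hk 1 0 (by simpa using hr.le))
  set g := (Set.Ioc (-r) r).indicator fun t => ‖dslope G 0 t‖ with hg_def
  have hr0 : Set.Icc (-r) r ∈ 𝓝 0 := Icc_mem_nhds (neg_lt_zero.2 hr) hr
  have hslope : ContinuousOn (fun t => ‖dslope G 0 t‖) (Set.Icc (-r) r) :=
    ((continuousOn_dslope hr0).2 ⟨hG, hG'.differentiableAt⟩).norm
  have hg : Integrable g :=
    (hslope.integrableOn_Icc.mono_set Set.Ioc_subset_Icc_self).integrable_indicator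
      measurableSet_Ioc
  have hg_eq : g =ᶠ[𝓝 0] fun t => ‖dslope G 0 t‖ := by
    filter_upwards [Ioc_mem_nhds (neg_lt_zero.2 hr) hr] with t ht
    exact Set.indicator_of_mem ht _
  have hg0 : ContinuousAt g 0 := (hslope.continuousAt hr0).congr hg_eq.symm
  have hlim := ((tendsto_integral_one_add_norm_rpow_smul ha hg hg0).comp
    tendsto_natCast_atTop_atTop).const_mul C
  rw [hg_eq.eq_of_nhds, dslope_same, hG'.deriv, norm_zero, smul_zero, mul_zero] at hlim
  have hmajor (n : ℕ) :=
    (integrable_one_add_norm_rpow_smul (zero_le_one.trans ha.le) hg n).const_mul C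
  refine squeeze_zero_norm (fun n => ?_) hlim
  rw [Function.comp_apply, ← integral_const_mul, ← setIntegral_eq_integral_of_forall_compl_eq_zero
    (s := Set.Ioc (-r) r) fun t ht => by
      rw [hg_def, Set.indicator_of_notMem ht, smul_zero, mul_zero],
    ← intervalIntegral.integral_of_le (by linarith)]
  refine intervalIntegral.norm_integral_le_of_norm_le (by linarith)
    (Eventually.of_forall fun t ht => ?_) (hmajor n).intervalIntegrable
  have hGt : G t = t • dslope G 0 t := by simpa [hG0] using (sub_smul_dslope G 0 t).symm
  have hkt : |k n t| * |t| ≤ C * (n * (1 + |n * t|) ^ (-a)) := calc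
    |k n t| * |t| ≤ C * n ^ 2 * (1 + |n * t|) ^ (-(a + 1)) * |t| := by
      gcongr
      exact hk n t (abs_le.2 ⟨ht.1.le, ht.2⟩)
    _ = C * (n * (|n * t| * (1 + |n * t|) ^ (-(a + 1)))) := by
      rw [abs_mul, Nat.abs_cast]
      ring
    _ ≤ C * (n * (1 + |n * t|) ^ (-a)) := by
      gcongr
      exact abs_mul_one_add_abs_rpow_le a _
  rw [hg_def, Set.indicator_of_mem ht, hGt, norm_smul, norm_smul, smul_eq_mul, ← mul_assoc,
    ← mul_assoc]
  exact mul_le_mul_of_nonneg_right hkt (norm_nonneg _)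

theorem tendsto_intervalIntegral_smul_of_hasDerivAt_primitive [CompleteSpace E] {φ : ℝ → E} {d : E}
    (hr : 0 < r) (ha : 1 < a) (hk : ∀ n, ContDiff ℝ 1 (k n))
    (hmean : Tendsto (fun n => ∫ t in -r..r, k n t) atTop (𝓝 1))
    (hneg : Tendsto (fun n => k n (-r)) atTop (𝓝 0)) (hpos : Tendsto (fun n => k n r) atTop (𝓝 0))
    (hderiv : ∀ n t, |t| ≤ r → |deriv (k n) t| ≤ C * n ^ 2 * (1 + |n * t|) ^ (-(a + 1)))
    (hφ : IntervalIntegrable φ volume (-r) r)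
    (hd : HasDerivAt (fun y => ∫ t in (0 : ℝ)..y, φ t) d 0) :
    Tendsto (fun n => ∫ t in -r..r, k n t • φ t) atTop (𝓝 d) := by
  have h0 : (0 : ℝ) ∈ Set.uIcc (-r) r := by simp [hr.le]
  have hψ : IntervalIntegrable (fun t => φ t - d) volume (-r) r :=
    hφ.sub intervalIntegrable_const
  set Ψ := fun y => ∫ t in (0 : ℝ)..y, (φ t - d) with hΨ_def
  have hΨ : ContinuousOn Ψ (Set.Icc (-r) r) := by
    rw [← Set.uIcc_of_le (by linarith)]
    exact intervalIntegral.continuousOn_primitive_interval' hψ h0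
  have hΨ' : HasDerivAt Ψ 0 0 := by
    have hΨ_eq : (fun y => (∫ t in (0 : ℝ)..y, φ t) - y • d) =ᶠ[𝓝 0] Ψ := by
      filter_upwards [Icc_mem_nhds (neg_lt_zero.2 hr) hr] with y hy
      rw [← Set.uIcc_of_le (by linarith)] at hy
      simp only [hΨ_def]
      rw [intervalIntegral.integral_sub (hφ.mono_set (Set.uIcc_subset_uIcc h0 hy))
        intervalIntegrable_const, intervalIntegral.integral_const, sub_zero]
    simpa using (hd.sub ((hasDerivAt_id (0 : ℝ)).smul_const d)).congr_of_eventuallyEq hΨ_eq.symm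
  have hlim := (((hpos.smul_const (Ψ r)).sub (hneg.smul_const (Ψ (-r)))).sub
    (tendsto_intervalIntegral_smul_of_hasDerivAt_zero hr ha hderiv hΨ
      intervalIntegral.integral_same hΨ')).add (hmean.smul_const d)
  simp only [zero_smul, sub_zero, one_smul, zero_add] at hlim
  refine hlim.congr fun n => ?_
  have hkd : IntervalIntegrable (fun t => k n t • d) volume (-r) r :=
    ((hk n).continuous.smul continuous_const).intervalIntegrable _ _
  have hkφ : IntervalIntegrable (fun t => k n t • φ t) volume (-r) r :=
    hφ.continuousOn_smul (hk n).continuous.continuousOn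
  rw [← integral_smul_eq_sub_integral_deriv_smul
    (hk n).contDiffOn.absolutelyContinuousOnInterval hψ h0, ← intervalIntegral.integral_smul_const]
  simp only [smul_sub]
  rw [intervalIntegral.integral_sub hkφ hkd, sub_add_cancel]

end SingularIntegrals

section CesaroNumbers

variable {α : ℝ}

theorem cesaroNumber_zero_right (α : ℝ) : cesaroNumber α 0 = 1 := by
  rw [cesaroNumber, Ring.choose_zero_right]

theorem cesaroNumber_succ_eq_mul (α : ℝ) (n : ℕ) :
    cesaroNumber α (n + 1) = cesaroNumber α n * ((α + n + 1) / (n + 1)) := by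
  have h := Ring.choose_smul_choose (α + (n + 1 : ℕ)) (Nat.le_add_left 1 n)
  have hsub : α + (n + 1 : ℕ) - 1 = α + n := by
    push_cast
    ring
  rw [Nat.choose_one_right, nsmul_eq_mul, Ring.choose_one_right, Nat.cast_one, hsub,
    Nat.add_sub_cancel] at h
  unfold cesaroNumber
  rw [mul_div_assoc', eq_div_iff (by positivity)]
  push_cast at h ⊢
  linear_combination h

theorem cesaroNumber_succ_eq_add (α : ℝ) (n : ℕ) :
    cesaroNumber α (n + 1) = cesaroNumber α n + cesaroNumber (α - 1) (n + 1) := by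
  have hα : α + (n + 1 : ℕ) = α + n + 1 := by
    push_cast
    ring
  have hα' : α - 1 + (n + 1 : ℕ) = α + n := by
    push_cast
    ring
  rw [cesaroNumber, cesaroNumber, cesaroNumber, hα, hα', Ring.choose_succ_succ]

theorem cesaroNumber_pos (hα : -1 < α) (n : ℕ) : 0 < cesaroNumber α n := by
  induction n with
  | zero => simp only [cesaroNumber_zero_right, zero_lt_one]
  | succ n ih =>
    rw [cesaroNumber_succ_eq_mul]
    have hn : 0 < α + n + 1 := by linarith [(n.cast_nonneg : (0 : ℝ) ≤ n)]
    positivity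

theorem cesaroNumber_mul_add (α : ℝ) (n : ℕ) :
    cesaroNumber α n * α = cesaroNumber (α - 1) n * (α + n) := by
  induction n with
  | zero => simp [cesaroNumber_zero_right]
  | succ n ih =>
    rw [cesaroNumber_succ_eq_mul, cesaroNumber_succ_eq_mul]
    field_simp
    push_cast
    linear_combination (α + n + 1) * ih

theorem cesaroNumber_sub_one_div (hα : 0 < α) (n : ℕ) :
    cesaroNumber (α - 1) n / cesaroNumber α n = α / (α + n) := by
  rw [div_eq_div_iff (cesaroNumber_pos (by linarith) n).ne' (by positivity), mul_comm α,
    cesaroNumber_mul_add]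

theorem cesaroNumber_sub_one_le_mul (hα : 0 < α) (hα1 : α ≤ 1) {τ : ℝ} {J : ℕ}
    (hJ : 1 ≤ J * τ) : cesaroNumber (α - 1) J ≤ cesaroNumber α J * τ := by
  have hA := cesaroNumber_pos (show -1 < α - 1 by linarith) J
  have hA' := cesaroNumber_pos (show -1 < α by linarith) J
  have hτ : 0 ≤ τ := (pos_of_mul_pos_right (zero_lt_one.trans_le hJ) J.cast_nonneg).le
  calc cesaroNumber (α - 1) J ≤ cesaroNumber (α - 1) J * ((α + J) * τ) := by
        refine le_mul_of_one_le_right hA.le (hJ.trans ?_)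
        gcongr
        exact le_add_of_nonneg_left hα.le
    _ = cesaroNumber α J * τ * α := by
        linear_combination -τ * cesaroNumber_mul_add α J
    _ ≤ cesaroNumber α J * τ := mul_le_of_le_one_right (by positivity) hα1

theorem sum_cesaroNumber (α : ℝ) (n : ℕ) :
    ∑ m ∈ range (n + 1), cesaroNumber (α - 1) m = cesaroNumber α n := by
  induction n with
  | zero => simp [cesaroNumber_zero_right]
  | succ n ih => rw [sum_range_succ, ih, cesaroNumber_succ_eq_add α]

theorem sum_cesaroNumber_reflect (α : ℝ) (n : ℕ) :
    ∑ m ∈ range (n + 1), cesaroNumber (α - 1) (n - m) = cesaroNumber α n := by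
  rw [← sum_cesaroNumber α n, ← sum_range_reflect (cesaroNumber (α - 1))]
  rfl

theorem antitone_cesaroNumber (hα : -1 < α) (hα0 : α ≤ 0) : Antitone (cesaroNumber α) := by
  refine antitone_nat_of_succ_le fun n => ?_
  rw [cesaroNumber_succ_eq_mul]
  refine mul_le_of_le_one_right (cesaroNumber_pos hα n).le ?_
  rw [div_le_one (by positivity)]
  linarith

theorem monotone_cesaroNumber_div_rpow (hα : 0 ≤ α) (hα1 : α ≤ 1) :
    Monotone fun n : ℕ => cesaroNumber α n / ((n : ℝ) + 1) ^ α := by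
  refine monotone_nat_of_le_succ fun n => ?_
  have hA := cesaroNumber_pos (show -1 < α by linarith) n
  have hn : (0 : ℝ) < n + 1 := by positivity
  have hbernoulli : (1 + 1 / ((n : ℝ) + 1)) ^ α ≤ 1 + α * (1 / (n + 1)) :=
    rpow_one_add_le_one_add_mul_self (neg_one_lt_zero.le.trans (by positivity)) hα hα1
  have hbase : ((n + 1 : ℕ) : ℝ) + 1 = (n + 1) * (1 + 1 / (n + 1)) := by
    push_cast
    field_simp
  have hratio : (α + n + 1) / ((n : ℝ) + 1) = 1 + α * (1 / (n + 1)) := by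
    field_simp
    ring
  rw [cesaroNumber_succ_eq_mul, div_le_div_iff₀ (by positivity) (by positivity), mul_assoc, hbase,
    hratio, mul_rpow hn.le (by positivity), mul_comm ((_ : ℝ) ^ α)]
  gcongr

theorem cesaroNumber_div_le (hα : 0 ≤ α) (hα1 : α ≤ 1) {j n : ℕ} (hjn : j ≤ n) :
    cesaroNumber α j / cesaroNumber α n ≤ (((j : ℝ) + 1) / (n + 1)) ^ α := by
  have hmono : cesaroNumber α j / ((j : ℝ) + 1) ^ α ≤ cesaroNumber α n / ((n : ℝ) + 1) ^ α :=
    monotone_cesaroNumber_div_rpow hα hα1 hjn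
  rw [div_le_div_iff₀ (by positivity) (by positivity)] at hmono
  rw [div_rpow (by positivity) (by positivity),
    div_le_div_iff₀ (cesaroNumber_pos (by linarith) n) (by positivity), mul_comm (_ ^ α)]
  exact hmono

theorem exists_le_mul_cesaroNumber_div_le (hα : 1 < α) (hα2 : α ≤ 2) {n : ℕ} {τ M : ℝ}
    (hτ : 0 < τ) (hτM : τ ≤ M) (hn : 1 ≤ n * τ) :
    ∃ J ≤ n, 1 ≤ J * τ ∧ (n + 1) * cesaroNumber (α - 1) J / cesaroNumber α n ≤
      α * (1 + 2 * M) * (n * τ) ^ (-(α - 1)) := by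
  have hM : 0 < M := hτ.trans_le hτM
  have hx : 0 < n * τ := zero_lt_one.trans_le hn
  have hn0 : 0 < (n : ℝ) := pos_of_mul_pos_left hx hτ.le
  have hJn : ⌈1 / τ⌉₊ ≤ n := by
    rwa [Nat.ceil_le, div_le_iff₀ hτ]
  refine ⟨⌈1 / τ⌉₊, hJn, (div_le_iff₀ hτ).1 (Nat.le_ceil _), ?_⟩
  set J := ⌈1 / τ⌉₊
  have hA := cesaroNumber_pos (show -1 < α - 1 by linarith) n
  have hAJ := cesaroNumber_pos (show -1 < α - 1 by linarith) J
  have hJ : (J + 1 : ℝ) / (n + 1) ≤ (1 + 2 * M) / (n * τ) := by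
    have hceil : (J : ℝ) < 1 / τ + 1 := Nat.ceil_lt_add_one (by positivity)
    have hτ1 : 1 ≤ M / τ := (one_le_div hτ).2 hτM
    calc (J + 1 : ℝ) / (n + 1) ≤ (1 / τ + 2 * (M / τ)) / n :=
          div_le_div₀ (by positivity) (by linarith) hn0 (by linarith)
      _ = (1 + 2 * M) / (n * τ) := by field_simp
  have hratio : cesaroNumber (α - 1) J / cesaroNumber (α - 1) n ≤
      (1 + 2 * M) * (n * τ) ^ (-(α - 1)) := by
    calc _ ≤ ((J + 1 : ℝ) / (n + 1)) ^ (α - 1) :=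
          cesaroNumber_div_le (by linarith) (by linarith) hJn
      _ ≤ ((1 + 2 * M) / (n * τ)) ^ (α - 1) := by gcongr
      _ = (1 + 2 * M) ^ (α - 1) * (n * τ) ^ (-(α - 1)) := by
          rw [div_rpow (by positivity) hx.le, rpow_neg hx.le, div_eq_mul_inv]
      _ ≤ (1 + 2 * M) * (n * τ) ^ (-(α - 1)) := by
          gcongr
          exact rpow_le_self_of_one_le (by linarith) (by linarith)
  calc (n + 1) * cesaroNumber (α - 1) J / cesaroNumber α n
      = (n + 1) * (cesaroNumber (α - 1) n / cesaroNumber α n) *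
          (cesaroNumber (α - 1) J / cesaroNumber (α - 1) n) := by field_simp
    _ ≤ α * ((1 + 2 * M) * (n * τ) ^ (-(α - 1))) := by
        gcongr
        rw [cesaroNumber_sub_one_div (by linarith), mul_div_assoc', div_le_iff₀ (by positivity)]
        nlinarith
    _ = _ := by ring

theorem one_add_mul_sum_le_cesaroNumber (hα : 0 ≤ α) (n : ℕ) :
    1 + α * ∑ i ∈ range n, 1 / ((i : ℝ) + 1) ≤ cesaroNumber α n := by
  induction n with
  | zero => simp [cesaroNumber_zero_right]
  | succ n ih =>
    have hA : 1 ≤ cesaroNumber α n := le_trans (le_add_of_nonneg_right (by positivity)) ih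
    have hstep : cesaroNumber α (n + 1) = cesaroNumber α n + cesaroNumber α n * (α / (n + 1)) := by
      rw [cesaroNumber_succ_eq_mul]
      field_simp
      ring
    have hinc : α / (n + 1) ≤ cesaroNumber α n * (α / (n + 1)) :=
      le_mul_of_one_le_left (by positivity) hA
    rw [sum_range_succ, hstep, mul_add, mul_one_div]
    linarith

theorem tendsto_cesaroNumber_atTop (hα : 0 < α) : Tendsto (cesaroNumber α) atTop atTop :=
  tendsto_atTop_mono (one_add_mul_sum_le_cesaroNumber hα.le) (tendsto_atTop_add_const_left _ 1
    (tendsto_sum_range_one_div_nat_succ_atTop.const_mul_atTop hα))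

theorem sum_cesaroNumber_mul_sub (α : ℝ) (c : ℕ → ℝ) (n : ℕ) :
    ∑ m ∈ range (n + 1), cesaroNumber α (n - m) * (c m - c (m + 1)) =
      cesaroNumber α n * c 0 - ∑ m ∈ range (n + 1), cesaroNumber (α - 1) (n - m) * c (m + 1) := by
  induction n generalizing c with
  | zero => simp [cesaroNumber_zero_right]
  | succ n ih =>
    rw [sum_range_succ', sum_range_succ' _ (n + 1)]
    simp only [Nat.add_sub_add_right, Nat.sub_zero, ih fun m => c (m + 1)]
    rw [cesaroNumber_succ_eq_add α]
    ring

end CesaroNumbers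

section CesaroMeans

variable {α : ℝ} {s : ℕ → ℂ} {d : ℂ}

theorem sum_cesaroNumber_mul_eq_sum_sum (α : ℝ) (s : ℕ → ℂ) (n : ℕ) :
    ∑ m ∈ range (n + 1), (cesaroNumber α (n - m) : ℂ) * s m =
      ∑ k ∈ range (n + 1), ∑ m ∈ range (k + 1), (cesaroNumber (α - 1) (k - m) : ℂ) * s m := by
  induction n with
  | zero => simp [cesaroNumber_zero_right]
  | succ n ih =>
    rw [sum_range_succ (fun k => ∑ m ∈ range (k + 1), _) (n + 1), ← ih, sum_range_succ _ (n + 1),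
      sum_range_succ _ (n + 1), ← add_assoc, ← sum_add_distrib]
    simp only [Nat.sub_self, cesaroNumber_zero_right]
    congr 1
    refine sum_congr rfl fun m hm => ?_
    rw [Nat.succ_sub (mem_range_succ_iff.1 hm), Nat.succ_eq_add_one, cesaroNumber_succ_eq_add α]
    push_cast
    ring

theorem cesaroMean_add_one (hα : -1 < α) (s : ℕ → ℂ) (n : ℕ) :
    cesaroMean (α + 1) s n = (∑ k ∈ range (n + 1), cesaroNumber α k)⁻¹ •
      ∑ k ∈ range (n + 1), cesaroNumber α k • cesaroMean α s k := by
  have hcancel (k : ℕ) : cesaroNumber α k • cesaroMean α s k =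
      ∑ m ∈ range (k + 1), (cesaroNumber (α - 1) (k - m) : ℂ) * s m := by
    rw [Complex.real_smul, cesaroMean,
      mul_div_cancel₀ _ (Complex.ofReal_ne_zero.2 (cesaroNumber_pos hα k).ne')]
  have hsum := sum_cesaroNumber (α + 1) n
  rw [add_sub_cancel_right] at hsum
  simp only [hcancel]
  rw [← sum_cesaroNumber_mul_eq_sum_sum, hsum, cesaroMean, add_sub_cancel_right,
    Complex.real_smul, Complex.ofReal_inv, div_eq_inv_mul]

theorem tendsto_cesaroMean_add_one (hα : -1 < α) (h : Tendsto (cesaroMean α s) atTop (𝓝 d)) :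
    Tendsto (cesaroMean (α + 1) s) atTop (𝓝 d) := by
  have hsum : Tendsto (fun n => ∑ k ∈ range n, cesaroNumber α k) atTop atTop := by
    refine (tendsto_add_atTop_iff_nat 1).1
      ((tendsto_cesaroNumber_atTop (by linarith : 0 < α + 1)).congr fun n => ?_)
    rw [← sum_cesaroNumber, add_sub_cancel_right]
  exact ((tendsto_add_atTop_iff_nat 1).2
    (tendsto_weighted_mean (fun k => (cesaroNumber_pos hα k).le) hsum h)).congr fun n =>
      (cesaroMean_add_one hα s n).symm

theorem tendsto_cesaroMean_add_nat (hα : -1 < α) (h : Tendsto (cesaroMean α s) atTop (𝓝 d))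
    (k : ℕ) : Tendsto (cesaroMean (α + k) s) atTop (𝓝 d) := by
  induction k with
  | zero => simpa only [Nat.cast_zero, add_zero] using h
  | succ k ih =>
    rw [Nat.cast_succ, ← add_assoc]
    exact tendsto_cesaroMean_add_one (by linarith [(k.cast_nonneg : (0 : ℝ) ≤ k)]) ih

end CesaroMeans

section Kernels

variable {α : ℝ}

/-- The Dirichlet kernel `∑_{|k| ≤ m} e^{ikt}`, written with cosines to make it real-valued; it
represents the partial sums of Fourier series as convolutions. -/
noncomputable def dirichletKernel (m : ℕ) (t : ℝ) : ℝ :=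
  1 + 2 * ∑ k ∈ range m, cos ((k + 1) * t)

/-- The kernel representing the Cesàro `(C, α)` means of Fourier series, with the same
normalisation as the Dirichlet kernel: its integral over a period is `2π`. -/
noncomputable def cesaroKernel (α : ℝ) (n : ℕ) (t : ℝ) : ℝ :=
  (∑ m ∈ range (n + 1), cesaroNumber (α - 1) (n - m) * dirichletKernel m t) / cesaroNumber α n

theorem contDiff_dirichletKernel (m : ℕ) : ContDiff ℝ 1 (dirichletKernel m) := by
  unfold dirichletKernel
  fun_prop

theorem contDiff_cesaroKernel (α : ℝ) (n : ℕ) : ContDiff ℝ 1 (cesaroKernel α n) :=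
  (ContDiff.sum fun m _ => contDiff_const.mul (contDiff_dirichletKernel m)).div_const _

theorem integral_dirichletKernel (m : ℕ) : ∫ t in -π..π, dirichletKernel m t = 2 * π := by
  have hint (k : ℕ) : IntervalIntegrable (fun t => cos (((k : ℝ) + 1) * t)) volume (-π) π :=
    (by fun_prop : Continuous _).intervalIntegrable _ _
  have hsum : IntervalIntegrable (fun t => 2 * ∑ k ∈ range m, cos (((k : ℝ) + 1) * t))
      volume (-π) π := (by fun_prop : Continuous _).intervalIntegrable _ _
  have hcos (k : ℕ) : ∫ t in -π..π, cos (((k : ℝ) + 1) * t) = 0 := by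
    have hsin : sin (((k : ℝ) + 1) * π) = 0 := mod_cast sin_nat_mul_pi (k + 1)
    rw [intervalIntegral.integral_comp_mul_left _ (by positivity), integral_cos, mul_neg, sin_neg,
      hsin, neg_zero, sub_zero, smul_zero]
  unfold dirichletKernel
  rw [intervalIntegral.integral_add intervalIntegrable_const hsum,
    intervalIntegral.integral_const_mul, intervalIntegral.integral_finsetSum fun k _ => hint k]
  simp only [hcos, sum_const_zero, mul_zero, add_zero, intervalIntegral.integral_const]
  simp only [smul_eq_mul]
  ring

theorem integral_cesaroKernel (hα : -1 < α) (n : ℕ) : ∫ t in -π..π, cesaroKernel α n t = 2 * π := by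
  have hint (m : ℕ) : IntervalIntegrable (fun t => cesaroNumber (α - 1) (n - m) *
      dirichletKernel m t) volume (-π) π :=
    ((contDiff_dirichletKernel m).continuous.intervalIntegrable _ _).const_mul _
  unfold cesaroKernel
  rw [intervalIntegral.integral_div, intervalIntegral.integral_finsetSum fun m _ => hint m]
  simp only [intervalIntegral.integral_const_mul, integral_dirichletKernel]
  rw [← sum_mul, sum_cesaroNumber_reflect, mul_div_cancel_left₀ _ (cesaroNumber_pos hα n).ne']

theorem one_sub_cos_mul_dirichletKernel (m : ℕ) (t : ℝ) :
    (1 - cos t) * dirichletKernel m t = cos (m * t) - cos ((m + 1) * t) := by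
  induction m with
  | zero => simp [dirichletKernel]
  | succ m ih =>
    have hstep : dirichletKernel (m + 1) t = dirichletKernel m t + 2 * cos ((m + 1) * t) := by
      simp only [dirichletKernel, sum_range_succ]
      ring
    have hadd : ((m + 1 : ℕ) + 1 : ℝ) * t = (m + 1) * t + t := by
      push_cast
      ring
    have hsub : (m : ℝ) * t = (m + 1) * t - t := by ring
    rw [hstep, mul_add, ih, hadd, hsub, cos_add, cos_sub]
    push_cast
    ring

theorem one_sub_cos_mul_cesaroKernel (α : ℝ) (n : ℕ) (t : ℝ) :
    (1 - cos t) * cesaroKernel α n t = (cesaroNumber (α - 1) n -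
      ∑ m ∈ range (n + 1), cesaroNumber (α - 2) (n - m) * cos ((m + 1) * t)) /
        cesaroNumber α n := by
  have habel := sum_cesaroNumber_mul_sub (α - 1) (fun m => cos (m * t)) n
  rw [sub_sub, one_add_one_eq_two] at habel
  push_cast at habel
  rw [zero_mul, cos_zero, mul_one] at habel
  rw [cesaroKernel, mul_div_assoc', mul_sum, ← habel]
  simp only [← one_sub_cos_mul_dirichletKernel, mul_left_comm]

theorem one_sub_cos_mul_abs_cesaroKernel_le (hα : 1 < α) (n : ℕ) (t : ℝ) :
    (1 - cos t) * |cesaroKernel α n t| ≤ 2 * (α / (α + n)) := by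
  have hA := cesaroNumber_pos (show -1 < α by linarith) n
  have hA' := cesaroNumber_pos (show -1 < α - 1 by linarith) n
  have hsum : |∑ m ∈ range (n + 1), cesaroNumber (α - 2) (n - m) * cos ((m + 1) * t)| ≤
      cesaroNumber (α - 1) n := by
    rw [← sum_cesaroNumber_reflect (α - 1) n, sub_sub, one_add_one_eq_two]
    refine (abs_sum_le_sum_abs _ _).trans (sum_le_sum fun m _ => ?_)
    have hp := cesaroNumber_pos (show -1 < α - 2 by linarith) (n - m)
    rw [abs_mul, abs_of_pos hp]
    exact mul_le_of_le_one_right hp.le (abs_cos_le_one _)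
  rw [← abs_of_nonneg (sub_nonneg.2 (cos_le_one t)), ← abs_mul, one_sub_cos_mul_cesaroKernel,
    abs_div, abs_of_pos hA, ← cesaroNumber_sub_one_div (by linarith), mul_div_assoc', two_mul]
  gcongr
  refine (abs_sub _ _).trans ?_
  rw [abs_of_pos hA']
  gcongr

theorem hasDerivAt_cos_mul (c t : ℝ) :
    HasDerivAt (fun t => cos (c * t)) (-(c * sin (c * t))) t := by
  simpa [mul_comm] using ((hasDerivAt_id t).const_mul c).cos

theorem one_sub_cos_mul_deriv_cesaroKernel (α : ℝ) (n : ℕ) (t : ℝ) :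
    (1 - cos t) * deriv (cesaroKernel α n) t =
      (∑ m ∈ range (n + 1), cesaroNumber (α - 2) (n - m) * ((m + 1) * sin ((m + 1) * t))) /
        cesaroNumber α n - sin t * cesaroKernel α n t := by
  have hK : HasDerivAt (cesaroKernel α n) (deriv (cesaroKernel α n) t) t :=
    ((contDiff_cesaroKernel α n).differentiable one_ne_zero t).hasDerivAt
  have hleft := ((hasDerivAt_cos t).const_sub 1).mul hK
  have hright := ((HasDerivAt.fun_sum fun (m : ℕ) (_ : m ∈ range (n + 1)) =>
    (hasDerivAt_cos_mul (m + 1) t).const_mul (cesaroNumber (α - 2) (n - m))).const_sub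
      (cesaroNumber (α - 1) n)).div_const (cesaroNumber α n)
  have heq := (hleft.congr_of_eventuallyEq (Eventually.of_forall fun t =>
    (one_sub_cos_mul_cesaroKernel α n t).symm)).unique hright
  simp only [mul_neg, sum_neg_distrib, neg_neg] at heq
  linear_combination heq

theorem abs_deriv_dirichletKernel_le (m : ℕ) (t : ℝ) :
    |deriv (dirichletKernel m) t| ≤ 2 * (m : ℝ) ^ 2 := by
  have hD : HasDerivAt (dirichletKernel m) (2 * ∑ k ∈ range m, -((k + 1) * sin ((k + 1) * t))) t :=
    ((HasDerivAt.fun_sum fun (k : ℕ) _ => hasDerivAt_cos_mul (k + 1) t).const_mul 2).const_add 1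
  have hterm (k : ℕ) (hk : k ∈ range m) : |-(((k : ℝ) + 1) * sin ((k + 1) * t))| ≤ m := by
    rw [abs_neg, abs_mul, abs_of_nonneg (by positivity)]
    refine (mul_le_of_le_one_right (by positivity) (abs_sin_le_one _)).trans ?_
    exact_mod_cast mem_range.1 hk
  rw [hD.deriv, abs_mul, abs_two, sq]
  gcongr
  simpa using (abs_sum_le_sum_abs _ _).trans (sum_le_sum hterm)

theorem abs_deriv_cesaroKernel_le (hα : 0 < α) (n : ℕ) (t : ℝ) :
    |deriv (cesaroKernel α n) t| ≤ 2 * (n : ℝ) ^ 2 := by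
  have hA := cesaroNumber_pos (show -1 < α by linarith) n
  have hK : HasDerivAt (cesaroKernel α n) ((∑ m ∈ range (n + 1),
      cesaroNumber (α - 1) (n - m) * deriv (dirichletKernel m) t) / cesaroNumber α n) t :=
    (HasDerivAt.fun_sum fun m _ => (((contDiff_dirichletKernel m).differentiable one_ne_zero
      t).hasDerivAt.const_mul _)).div_const _
  rw [hK.deriv, abs_div, abs_of_pos hA, div_le_iff₀ hA, ← sum_cesaroNumber_reflect α n, mul_sum]
  refine (abs_sum_le_sum_abs _ _).trans (sum_le_sum fun m hm => ?_)
  have hp := cesaroNumber_pos (show -1 < α - 1 by linarith) (n - m)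
  rw [abs_mul, abs_of_pos hp, mul_comm]
  gcongr
  refine (abs_deriv_dirichletKernel_le m t).trans ?_
  gcongr
  exact mem_range_succ_iff.1 hm

theorem abs_sum_reflect_mul_sin_le (c : ℕ → ℝ) (n : ℕ) (t : ℝ) :
    |∑ m ∈ range (n + 1), c (n - m) * sin ((m + 1) * t)| ≤
      ‖∑ j ∈ range (n + 1), (c j : ℂ) * Complex.exp (↑(-t) * Complex.I) ^ j‖ := by
  have him : ∑ m ∈ range (n + 1), c (n - m) * sin ((m + 1) * t) =
      (Complex.exp (↑((n + 1) * t) * Complex.I) *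
        ∑ j ∈ range (n + 1), (c j : ℂ) * Complex.exp (↑(-t) * Complex.I) ^ j).im := by
    rw [mul_sum, Complex.im_sum, ← sum_range_reflect]
    refine sum_congr rfl fun j hj => ?_
    have hjn : j ≤ n := mem_range_succ_iff.1 hj
    have hexp : Complex.exp (↑((n + 1) * t) * Complex.I) *
        ((c j : ℂ) * Complex.exp (↑(-t) * Complex.I) ^ j) =
          (c j : ℂ) * Complex.exp (↑(((n - j : ℕ) + 1) * t) * Complex.I) := by
      rw [← Complex.exp_nat_mul, mul_left_comm, ← Complex.exp_add, Nat.cast_sub hjn]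
      push_cast
      ring_nf
    rw [hexp, Complex.im_ofReal_mul, Complex.exp_ofReal_mul_I_im, Nat.add_sub_cancel,
      Nat.sub_sub_self hjn]
  rw [him]
  refine (Complex.abs_im_le_norm _).trans_eq ?_
  rw [norm_mul, Complex.norm_exp_ofReal_mul_I, one_mul]

theorem two_mul_abs_div_pi_le_norm_one_sub_exp {t : ℝ} (ht : |t| ≤ π) :
    2 * |t| / π ≤ ‖1 - Complex.exp (↑(-t) * Complex.I)‖ := by
  have hhalf : 2 / π * |t / 2| ≤ |sin (t / 2)| := by
    refine mul_abs_le_abs_sin ?_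
    rw [abs_div, abs_two]
    gcongr
  have hnorm := Complex.norm_exp_I_mul_ofReal_sub_one (-t)
  rw [mul_comm Complex.I] at hnorm
  rw [norm_sub_rev, hnorm, norm_eq_abs, abs_mul, abs_two, neg_div, sin_neg, abs_neg]
  rw [abs_div, abs_two] at hhalf
  calc 2 * |t| / π = 2 * (2 / π * (|t| / 2)) := by ring
    _ ≤ 2 * |sin (t / 2)| := by gcongr

theorem norm_sum_cesaroNumber_mul_pow_le {β : ℝ} (hβ : 0 < β) (hβ1 : β ≤ 1) {w : ℂ}
    (hw : ‖w‖ ≤ 1) (hw1 : w ≠ 1) {n J : ℕ} (hJn : J ≤ n) :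
    ‖∑ j ∈ range (n + 1), ((((n + 1 - j : ℕ) : ℝ) * cesaroNumber (β - 1) j : ℝ) : ℂ) * w ^ j‖ ≤
      (n + 1) * (cesaroNumber β J + 2 * cesaroNumber (β - 1) J / ‖1 - w‖) := by
  have hA (j : ℕ) : 0 < cesaroNumber (β - 1) j := cesaroNumber_pos (by linarith) j
  set c : ℕ → ℝ := fun j => ((n + 1 - j : ℕ) : ℝ) * cesaroNumber (β - 1) j
  have hc0 : 0 ≤ c := fun j => mul_nonneg (Nat.cast_nonneg _) (hA j).le
  have hc : Antitone c := fun i j hij => mul_le_mul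
    (by exact_mod_cast Nat.sub_le_sub_left hij _)
    (antitone_cesaroNumber (by linarith) (by linarith) hij) (hA j).le (Nat.cast_nonneg _)
  have hc_le (j : ℕ) : c j ≤ (n + 1) * cesaroNumber (β - 1) j := by
    refine mul_le_mul_of_nonneg_right ?_ (hA j).le
    exact_mod_cast Nat.sub_le _ _
  have hsum : ∑ j ∈ range J, c j ≤ (n + 1) * cesaroNumber β J := by
    refine (sum_le_sum fun j _ => hc_le j).trans ?_
    rw [← mul_sum, ← sum_cesaroNumber β J, sum_range_succ]
    gcongr
    exact le_add_of_nonneg_right (hA J).le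
  calc _ ≤ ∑ j ∈ range J, c j + 2 * c J / ‖1 - w‖ :=
        norm_sum_antitone_mul_pow_le hc hc0 hw hw1 (hJn.trans n.le_succ)
    _ ≤ (n + 1) * cesaroNumber β J + 2 * ((n + 1) * cesaroNumber (β - 1) J) / ‖1 - w‖ := by
        gcongr
        exact hc_le J
    _ = _ := by ring

theorem abs_sum_cesaroNumber_mul_sin_le {β t : ℝ} (hβ : 0 < β) (hβ1 : β ≤ 1) (ht : |t| ≤ π)
    {n J : ℕ} (hJn : J ≤ n) (hJ : 1 ≤ J * |t|) :
    |∑ m ∈ range (n + 1), cesaroNumber (β - 1) (n - m) * ((m + 1) * sin ((m + 1) * t))| ≤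
      (n + 1) * ((1 + π) * cesaroNumber β J) := by
  have hτ : 0 < |t| := pos_of_mul_pos_right (zero_lt_one.trans_le hJ) J.cast_nonneg
  have hA := cesaroNumber_pos (show -1 < β by linarith) J
  set w := Complex.exp (↑(-t) * Complex.I)
  have hw : 2 * |t| / π ≤ ‖1 - w‖ := two_mul_abs_div_pi_le_norm_one_sub_exp ht
  have hw1 : w ≠ 1 := by
    rw [ne_comm, ← sub_ne_zero, ← norm_pos_iff]
    exact lt_of_lt_of_le (by positivity) hw
  have htail : 2 * cesaroNumber (β - 1) J / ‖1 - w‖ ≤ π * cesaroNumber β J := by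
    calc 2 * cesaroNumber (β - 1) J / ‖1 - w‖
        ≤ 2 * (cesaroNumber β J * |t|) / (2 * |t| / π) := by
          gcongr
          exact cesaroNumber_sub_one_le_mul hβ hβ1 hJ
      _ = π * cesaroNumber β J := by field_simp
  have hreflect (m : ℕ) (hm : m ∈ range (n + 1)) :
      cesaroNumber (β - 1) (n - m) * ((m + 1) * sin ((m + 1) * t)) =
        ((n + 1 - (n - m) : ℕ) : ℝ) * cesaroNumber (β - 1) (n - m) * sin ((m + 1) * t) := by
    have hmn : n + 1 - (n - m) = m + 1 := by
      have := mem_range_succ_iff.1 hm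
      lia
    rw [hmn]
    push_cast
    ring
  rw [sum_congr rfl hreflect]
  calc _ ≤ (n + 1) * (cesaroNumber β J + 2 * cesaroNumber (β - 1) J / ‖1 - w‖) :=
        (abs_sum_reflect_mul_sin_le
          (fun j => ((n + 1 - j : ℕ) : ℝ) * cesaroNumber (β - 1) j) n t).trans
            (norm_sum_cesaroNumber_mul_pow_le hβ hβ1 (Complex.norm_exp_ofReal_mul_I _).le hw1 hJn)
    _ ≤ (n + 1) * (cesaroNumber β J + π * cesaroNumber β J) := by gcongr
    _ = (n + 1) * ((1 + π) * cesaroNumber β J) := by ring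

theorem abs_sin_mul_cesaroKernel_le (hα : 1 < α) {n : ℕ} {t : ℝ} (ht : |t| ≤ π)
    (hn : 0 < n * |t|) : |sin t * cesaroKernel α n t| ≤ α * π ^ 2 * (n * |t|)⁻¹ := by
  have hτ : 0 < |t| := pos_of_mul_pos_right hn n.cast_nonneg
  have hn0 : 0 < (n : ℝ) := pos_of_mul_pos_left hn hτ.le
  have hK : 2 / π ^ 2 * |t| ^ 2 * |cesaroKernel α n t| ≤ 2 * (α / n) := by
    rw [sq_abs]
    calc _ ≤ (1 - cos t) * |cesaroKernel α n t| := by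
          gcongr
          exact le_sub_comm.1 (cos_le_one_sub_mul_cos_sq ht)
      _ ≤ 2 * (α / (α + n)) := one_sub_cos_mul_abs_cesaroKernel_le hα n t
      _ ≤ 2 * (α / n) := by
          gcongr
          linarith
  calc |sin t * cesaroKernel α n t| ≤ |t| * |cesaroKernel α n t| := by
        rw [abs_mul]
        exact mul_le_mul_of_nonneg_right abs_sin_le_abs (abs_nonneg _)
    _ = π ^ 2 / (2 * |t|) * (2 / π ^ 2 * |t| ^ 2 * |cesaroKernel α n t|) := by field_simp
    _ ≤ π ^ 2 / (2 * |t|) * (2 * (α / n)) := by gcongr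
    _ = α * π ^ 2 * (n * |t|)⁻¹ := by field_simp

theorem one_sub_cos_mul_abs_deriv_cesaroKernel_le (hα : 1 < α) (hα2 : α ≤ 2) {n : ℕ} {t : ℝ}
    (ht : |t| ≤ π) (hn : 1 ≤ n * |t|) :
    (1 - cos t) * |deriv (cesaroKernel α n) t| ≤
      α * ((1 + π) * (1 + 2 * π) + π ^ 2) * (n * |t|) ^ (-(α - 1)) := by
  have hx : 0 < n * |t| := zero_lt_one.trans_le hn
  have hτ : 0 < |t| := pos_of_mul_pos_right hx n.cast_nonneg
  have hA := cesaroNumber_pos (show -1 < α by linarith) n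
  obtain ⟨J, hJn, hJ, hbound⟩ := exists_le_mul_cesaroNumber_div_le hα hα2 hτ ht hn
  have hsum : |∑ m ∈ range (n + 1), cesaroNumber (α - 2) (n - m) *
      ((m + 1) * sin ((m + 1) * t))| / cesaroNumber α n ≤
        α * ((1 + π) * (1 + 2 * π)) * (n * |t|) ^ (-(α - 1)) := by
    have h := abs_sum_cesaroNumber_mul_sin_le (show 0 < α - 1 by linarith) (by linarith) ht hJn hJ
    rw [sub_sub, one_add_one_eq_two] at h
    calc _ ≤ (n + 1) * ((1 + π) * cesaroNumber (α - 1) J) / cesaroNumber α n := by gcongr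
      _ = (1 + π) * ((n + 1) * cesaroNumber (α - 1) J / cesaroNumber α n) := by ring
      _ ≤ (1 + π) * (α * (1 + 2 * π) * (n * |t|) ^ (-(α - 1))) := by gcongr
      _ = _ := by ring
  have hkernel : |sin t * cesaroKernel α n t| ≤ α * π ^ 2 * (n * |t|) ^ (-(α - 1)) := by
    refine (abs_sin_mul_cesaroKernel_le hα ht hx).trans ?_
    rw [← rpow_neg_one]
    gcongr
    linarith
  rw [← abs_of_nonneg (sub_nonneg.2 (cos_le_one t)), ← abs_mul,
    one_sub_cos_mul_deriv_cesaroKernel]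
  refine (abs_sub _ _).trans ?_
  rw [abs_div, abs_of_pos hA]
  linarith

theorem abs_deriv_cesaroKernel_le_mul_rpow (hα : 1 < α) (hα2 : α ≤ 2) {n : ℕ} {t : ℝ}
    (ht : |t| ≤ π) (hn : 1 ≤ n * |t|) :
    |deriv (cesaroKernel α n) t| ≤ π ^ 2 / 2 * (α * ((1 + π) * (1 + 2 * π) + π ^ 2)) * n ^ 2 *
      (n * |t|) ^ (-(α + 1)) := by
  have hx : 0 < n * |t| := zero_lt_one.trans_le hn
  have hτ : 0 < |t| := pos_of_mul_pos_right hx n.cast_nonneg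
  have hpow : (n * |t|) ^ (-(α - 1)) = (n * |t|) ^ 2 * (n * |t|) ^ (-(α + 1)) := by
    rw [← rpow_natCast, ← rpow_add hx]
    norm_num
    ring_nf
  have hderiv : 2 / π ^ 2 * |t| ^ 2 * |deriv (cesaroKernel α n) t| ≤
      α * ((1 + π) * (1 + 2 * π) + π ^ 2) * (n * |t|) ^ (-(α - 1)) := by
    rw [sq_abs]
    exact (mul_le_mul_of_nonneg_right (le_sub_comm.1 (cos_le_one_sub_mul_cos_sq ht))
      (abs_nonneg _)).trans (one_sub_cos_mul_abs_deriv_cesaroKernel_le hα hα2 ht hn)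
  calc |deriv (cesaroKernel α n) t|
      = π ^ 2 / (2 * |t| ^ 2) * (2 / π ^ 2 * |t| ^ 2 * |deriv (cesaroKernel α n) t|) := by
        field_simp
    _ ≤ π ^ 2 / (2 * |t| ^ 2) * (α * ((1 + π) * (1 + 2 * π) + π ^ 2) *
          ((n * |t|) ^ 2 * (n * |t|) ^ (-(α + 1)))) := by
        rw [← hpow]
        exact mul_le_mul_of_nonneg_left hderiv (by positivity)
    _ = _ := by field_simp

theorem exists_abs_deriv_cesaroKernel_le (hα : 1 < α) (hα2 : α ≤ 2) :
    ∃ C, ∀ (n : ℕ) (t : ℝ), |t| ≤ π →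
      |deriv (cesaroKernel α n) t| ≤ C * n ^ 2 * (1 + |n * t|) ^ (-(α + 1)) := by
  set C := π ^ 2 / 2 * (α * ((1 + π) * (1 + 2 * π) + π ^ 2))
  have hC : 0 ≤ C := by positivity
  refine ⟨(2 + C) * 2 ^ (α + 1), fun n t ht => ?_⟩
  have hscale {x y : ℝ} (hx : 0 < x) (hy : 0 < y) (hxy : x ≤ 2 * y) :
      y ^ (-(α + 1)) ≤ 2 ^ (α + 1) * x ^ (-(α + 1)) := by
    calc y ^ (-(α + 1)) = 2 ^ (α + 1) * (2 * y) ^ (-(α + 1)) := by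
          rw [mul_rpow two_pos.le hy.le, ← mul_assoc, ← rpow_add two_pos, add_neg_cancel,
            rpow_zero, one_mul]
      _ ≤ 2 ^ (α + 1) * x ^ (-(α + 1)) := by
          gcongr 2 ^ (α + 1) * ?_
          exact rpow_le_rpow_of_nonpos hx hxy (by linarith)
  rw [abs_mul, Nat.abs_cast]
  have hx : 0 ≤ n * |t| := by positivity
  rcases le_total 1 (n * |t|) with h | h
  · calc _ ≤ C * n ^ 2 * (n * |t|) ^ (-(α + 1)) := abs_deriv_cesaroKernel_le_mul_rpow hα hα2 ht h
      _ ≤ (2 + C) * n ^ 2 * (2 ^ (α + 1) * (1 + n * |t|) ^ (-(α + 1))) := by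
          gcongr
          · linarith
          · exact hscale (by linarith) (by linarith) (by linarith)
      _ = _ := by ring
  · calc _ ≤ 2 * (n : ℝ) ^ 2 * 1 ^ (-(α + 1)) := by
          rw [one_rpow, mul_one]
          exact abs_deriv_cesaroKernel_le (by linarith) n t
      _ ≤ (2 + C) * n ^ 2 * (2 ^ (α + 1) * (1 + n * |t|) ^ (-(α + 1))) := by
          gcongr
          · linarith
          · exact hscale (by linarith) one_pos (by linarith)
      _ = _ := by ring

theorem cesaroKernel_neg (α : ℝ) (n : ℕ) (t : ℝ) : cesaroKernel α n (-t) = cesaroKernel α n t := by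
  simp only [cesaroKernel, dirichletKernel, mul_neg, cos_neg]

theorem tendsto_cesaroKernel_pi (hα : 1 < α) :
    Tendsto (fun n => cesaroKernel α n π) atTop (𝓝 0) := by
  have hlim : Tendsto (fun n : ℕ => α / (α + n)) atTop (𝓝 0) :=
    (tendsto_atTop_add_const_left _ _ tendsto_natCast_atTop_atTop).const_div_atTop α
  refine squeeze_zero_norm (fun n => ?_) hlim
  have h := one_sub_cos_mul_abs_cesaroKernel_le hα n π
  rw [cos_pi] at h
  rw [norm_eq_abs]
  linarith

end Kernels

section FourierSeries

theorem sum_exp_eq_dirichletKernel (m : ℕ) (t : ℝ) :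
    ∑ k ∈ Icc (-(m : ℤ)) m, Complex.exp (k * t * Complex.I) = dirichletKernel m t := by
  induction m with
  | zero => simp [dirichletKernel]
  | succ m ih =>
    have hIcc : Icc (-((m + 1 : ℕ) : ℤ)) (m + 1 : ℕ) =
        insert (-((m + 1 : ℕ) : ℤ)) (insert ((m + 1 : ℕ) : ℤ) (Icc (-(m : ℤ)) m)) := by
      ext k
      simp only [mem_Icc, mem_insert]
      lia
    rw [hIcc, sum_insert (by simp only [mem_insert, mem_Icc]; lia),
      sum_insert (by simp only [mem_Icc]; lia), ih]
    simp only [dirichletKernel, sum_range_succ]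
    push_cast
    rw [mul_add 2, ← add_assoc, ← add_assoc, Complex.two_cos]
    ring_nf

variable {f : Torus → ℂ}

theorem intervalIntegrable_of_integrable_haarAddCircle
    (hf : Integrable f AddCircle.haarAddCircle) (a b : ℝ) :
    IntervalIntegrable (fun t : ℝ => f t) volume a b := by
  have hvol : Integrable f volume := by
    rw [AddCircle.volume_eq_smul_haarAddCircle]
    exact hf.smul_measure ENNReal.ofReal_ne_top
  have hper : Function.Periodic (fun t : ℝ => f t) (2 * π) := fun t => by
    simp only [AddCircle.coe_add_period]
  refine hper.intervalIntegrable two_pi_pos.ne' (t := 0) ?_ a b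
  rw [intervalIntegrable_iff_integrableOn_Ioc_of_le (by linarith [two_pi_pos])]
  exact (AddCircle.measurePreserving_mk (2 * π) 0).integrable_comp_of_integrable hvol

theorem intervalIntegrable_comp_add_left (hf : Integrable f AddCircle.haarAddCircle)
    (x a b : ℝ) : IntervalIntegrable (fun t : ℝ => f ((x + t : ℝ) : Torus)) volume a b := by
  simpa using (intervalIntegrable_of_integrable_haarAddCircle hf (x + a) (x + b)).comp_add_left x

theorem fourierCoeff_mul_fourier_eq_integral (f : Torus → ℂ) (k : ℤ) (x : ℝ) :
    fourierCoeff f k * fourier k (x : Torus) = (2 * π : ℂ)⁻¹ *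
      ∫ t in -π..π, Complex.exp (↑(-k) * t * Complex.I) * f ((x + t : ℝ) : Torus) := by
  have hexp (t : ℝ) : fourier (-k) ((x + t : ℝ) : Torus) * fourier k (x : Torus) =
      Complex.exp (↑(-k) * t * Complex.I) := by
    simp only [fourier_coe_apply]
    rw [← Complex.exp_add]
    congr 1
    push_cast
    field_simp
    ring
  have hshift : ∫ t in x - π..x - π + 2 * π, fourier (-k) (t : Torus) • f t =
      ∫ t in -π..π, fourier (-k) ((x + t : ℝ) : Torus) • f ((x + t : ℝ) : Torus) := by
    rw [intervalIntegral.integral_comp_add_left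
      (fun t : ℝ => fourier (-k) (t : Torus) • f (t : Torus))]
    congr 1
    ring
  rw [fourierCoeff_eq_intervalIntegral f k (x - π), hshift, Complex.real_smul, mul_assoc,
    ← intervalIntegral.integral_mul_const]
  simp only [smul_eq_mul, mul_right_comm _ (f _), hexp]
  push_cast
  rw [one_div]

theorem fourierPartialSum_eq_integral (hf : Integrable f AddCircle.haarAddCircle) (m : ℕ) (x : ℝ) :
    fourierPartialSum f m x =
      (2 * π : ℂ)⁻¹ * ∫ t in -π..π, dirichletKernel m t * f ((x + t : ℝ) : Torus) := by
  have hint (k : ℤ) : IntervalIntegrable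
      (fun t : ℝ => Complex.exp (↑(-k) * t * Complex.I) * f ((x + t : ℝ) : Torus))
      volume (-π) π :=
    (intervalIntegrable_comp_add_left hf x _ _).continuousOn_mul
      (Continuous.continuousOn (by fun_prop))
  have hneg (t : ℝ) : ∑ k ∈ Icc (-(m : ℤ)) m, Complex.exp (↑(-k) * t * Complex.I) =
      dirichletKernel m t := by
    rw [← sum_exp_eq_dirichletKernel]
    exact sum_equiv (Equiv.neg ℤ) (fun k => by simp only [mem_Icc, Equiv.neg_apply]; lia)
      fun k _ => rfl
  simp only [fourierPartialSum, fourierCoeff_mul_fourier_eq_integral]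
  rw [← mul_sum, ← intervalIntegral.integral_finsetSum fun k _ => hint k]
  simp only [← sum_mul, hneg]

theorem cesaroMean_fourierPartialSum_eq_integral (hf : Integrable f AddCircle.haarAddCircle)
    (α : ℝ) (n : ℕ) (x : ℝ) :
    cesaroMean α (fun m => fourierPartialSum f m x) n =
      ∫ t in -π..π, (cesaroKernel α n t / (2 * π)) • f ((x + t : ℝ) : Torus) := by
  have hint (m : ℕ) : IntervalIntegrable (fun t : ℝ => (cesaroNumber (α - 1) (n - m) : ℂ) *
      (dirichletKernel m t * f ((x + t : ℝ) : Torus))) volume (-π) π :=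
    ((intervalIntegrable_comp_add_left hf x _ _).continuousOn_mul
      (Complex.continuous_ofReal.comp
        (contDiff_dirichletKernel m).continuous).continuousOn).const_mul _
  simp only [cesaroMean, fourierPartialSum_eq_integral hf, mul_left_comm _ (2 * π : ℂ)⁻¹]
  rw [← mul_sum, mul_div_assoc]
  simp only [← intervalIntegral.integral_const_mul]
  rw [← intervalIntegral.integral_finsetSum fun m _ => hint m, ← intervalIntegral.integral_div,
    ← intervalIntegral.integral_const_mul]
  refine intervalIntegral.integral_congr fun t _ => ?_
  simp only [cesaroKernel, Complex.real_smul, ← mul_assoc, ← sum_mul]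
  push_cast
  ring

theorem IsDPoint.hasDerivAt_integral_comp_add {x : ℝ} {d : ℂ} (hx : IsDPoint f x d)
    (hf : Integrable f AddCircle.haarAddCircle) :
    HasDerivAt (fun y : ℝ => ∫ t in (0 : ℝ)..y, f ((x + t : ℝ) : Torus)) d 0 := by
  have hint (a b : ℝ) := intervalIntegrable_of_integrable_haarAddCircle hf a b
  have hshift : (fun y : ℝ => ∫ t in (0 : ℝ)..y, f ((x + t : ℝ) : Torus)) = fun y =>
      (∫ t in (0 : ℝ)..x + y, f (t : Torus)) - ∫ t in (0 : ℝ)..x, f (t : Torus) := by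
    funext y
    rw [intervalIntegral.integral_interval_sub_left (hint _ _) (hint _ _),
      intervalIntegral.integral_comp_add_left (fun t : ℝ => f (t : Torus)), add_zero]
  have hx0 : HasDerivAt (fun y : ℝ => ∫ t in (0 : ℝ)..y, f (t : Torus)) d (x + 0) := by
    rwa [add_zero]
  rw [hshift]
  exact (hx0.comp_const_add x 0).sub_const _

theorem IsDPoint.tendsto_cesaroMean_of_le_two {α : ℝ} (hα : 1 < α) (hα2 : α ≤ 2) {x : ℝ} {d : ℂ}
    (hx : IsDPoint f x d) (hf : Integrable f AddCircle.haarAddCircle) :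
    Tendsto (cesaroMean α fun m => fourierPartialSum f m x) atTop (𝓝 d) := by
  obtain ⟨C, hC⟩ := exists_abs_deriv_cesaroKernel_le hα hα2
  have hpi : Tendsto (fun n => cesaroKernel α n π / (2 * π)) atTop (𝓝 0) := by
    simpa using (tendsto_cesaroKernel_pi hα).div_const (2 * π)
  have hmean (n : ℕ) : ∫ t in -π..π, cesaroKernel α n t / (2 * π) = 1 := by
    rw [intervalIntegral.integral_div, integral_cesaroKernel (by linarith),
      div_self two_pi_pos.ne']
  have hderiv (n : ℕ) (t : ℝ) (ht : |t| ≤ π) : |deriv (fun t => cesaroKernel α n t / (2 * π)) t| ≤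
      C / (2 * π) * n ^ 2 * (1 + |n * t|) ^ (-(α + 1)) := by
    rw [deriv_div_const, abs_div, abs_of_pos two_pi_pos, mul_assoc, div_mul_eq_mul_div, ← mul_assoc]
    gcongr
    exact hC n t ht
  have hlim := tendsto_intervalIntegral_smul_of_hasDerivAt_primitive pi_pos hα
    (fun n => (contDiff_cesaroKernel α n).div_const (2 * π))
    (by simp only [hmean, tendsto_const_nhds])
    (by simpa only [cesaroKernel_neg] using hpi) hpi hderiv
    (intervalIntegrable_comp_add_left hf x _ _) (hx.hasDerivAt_integral_comp_add hf)
  exact hlim.congr fun n => (cesaroMean_fourierPartialSum_eq_integral hf α n x).symm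

end FourierSeries

theorem corollary3 (α : ℝ) (hα : 1 < α) (f : Torus → ℂ)
    (hf : Integrable f (AddCircle.haarAddCircle : Measure Torus))
    (x : ℝ) (d : ℂ) (hx : IsDPoint f x d) :
    Tendsto (fun n : ℕ => cesaroMean α (fun m => fourierPartialSum f m x) n) atTop (𝓝 d) := by
  obtain ⟨k, hk, hk2⟩ : ∃ k : ℕ, 1 < α - k ∧ α - k ≤ 2 := by
    have hceil : 2 ≤ ⌈α⌉₊ := Nat.lt_ceil.2 (by exact_mod_cast hα)
    refine ⟨⌈α⌉₊ - 2, ?_, ?_⟩ <;> push_cast [hceil] <;>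
      linarith [Nat.ceil_lt_add_one (zero_le_one.trans hα.le), Nat.le_ceil α]
  have hmean := tendsto_cesaroMean_add_nat (by linarith)
    (hx.tendsto_cesaroMean_of_le_two hk hk2 hf) k
  rwa [sub_add_cancel] at hmean
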